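/- Let $\sigma:[0,\infty)\to\mathbb{R}$ be right-continuous and nondecreasing, and let $F:[0,\infty)\times[0,\infty)\to[0,\infty)$ be continuous, with $F(x,y)>0$ for all $x\ge 0$, $y>0$, and such that for each $x\ge 0$ the function $y\mapsto F(x,y)$ is nondecreasing on $(0,\infty)$. For $a\ge 0$, a solution on $[a,\infty)$ of the Volterra--Stieltjes integro-differential equation $$y'(x)=y'(a)-\int_a^x F(t,y(t))\,d\sigma(t)\qquad(x\ge a)\qquad(*)$$ is a locally absolutely continuous function $y:[a,\infty)\to[0,\infty)$ which has a right derivative $y'(x)$ at every $x\ge a$ and satisfies $(*)$ at every $x\ge a$ (Stieltjes integral over $(a,x]$). The solution is called asymptotically linear if there are constants $A>0$ and $B\in\mathbb{R}$ with $y(x)\sim Ax+B$ as $x\to\infty$, that is, $y(x)/(Ax+B)\to 1$. Then there exist $a\ge 0$ and an asymptotically linear solution of $(*)$ on $[a,\infty)$ if and only if $$\int_0^\infty F(t,Mt)\,d\sigma(t)<\infty\quad\text{for some } M>0.$$ -/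

import Mathlib

open Set Filter Topology MeasureTheory Asymptotics

/-- The Stieltjes function on the whole line obtained from a function `σ` that is nondecreasing
and right-continuous on `[0, ∞)`, by giving it the constant value `σ 0` to the left of `0`. -/
noncomputable def stieltjesOfHalfLine (σ : ℝ → ℝ) (hmono : MonotoneOn σ (Ici 0))
    (hright : ∀ x ∈ Ici (0 : ℝ), ContinuousWithinAt σ (Ici x) x) : StieltjesFunction ℝ where
  toFun x := σ (max x 0)
  mono' x y hxy :=
    hmono (mem_Ici.2 (le_max_right x 0)) (mem_Ici.2 (le_max_right y 0)) (max_le_max_right 0 hxy)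
  right_continuous' x :=
    ContinuousWithinAt.comp (t := Ici (max x 0)) (hright _ (mem_Ici.2 (le_max_right x 0)))
      (by fun_prop) (fun _ hy => mem_Ici.2 (max_le_max_right 0 (mem_Ici.1 hy)))

/-- The Stieltjes measure `dσ` on `[0, ∞)`: it gives `(s, t]` the mass `σ t - σ s` for
`0 ≤ s ≤ t`, and it gives no mass to `(-∞, 0]`. For `0 ≤ a ≤ x` and `f` continuous on `[a, x]`,
the Riemann-Stieltjes integral of `f` against `σ` over `[a, x]` is the integral of `f` against
this measure over `(a, x]`. -/
noncomputable def stieltjesMeasure (σ : ℝ → ℝ) (hmono : MonotoneOn σ (Ici 0))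
    (hright : ∀ x ∈ Ici (0 : ℝ), ContinuousWithinAt σ (Ici x) x) : Measure ℝ :=
  (stieltjesOfHalfLine σ hmono hright).measure

/-- `y` is a solution on `[a, ∞)` of the Volterra-Stieltjes integro-differential equation
`y' x = y' a - ∫_a^x F (t, y t) dσ t`, in which `y'` is the right derivative and `F` is a function
on `[0, ∞) × [0, ∞)`; here `μ` is the Stieltjes measure `dσ`. -/
structure IsSolutionOn (μ : Measure ℝ) (F : ℝ → ℝ → ℝ) (a : ℝ) (y : ℝ → ℝ) : Prop where
  /-- `y` is locally absolutely continuous on `[a, ∞)`. -/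
  absCont : ∀ b, a ≤ b → AbsolutelyContinuousOnInterval y a b
  /-- `y` takes its values where the nonlinearity is defined. -/
  nonneg : ∀ x, a ≤ x → 0 ≤ y x
  /-- `y` has a right derivative at every point of `[a, ∞)`. -/
  differentiable : ∀ x, a ≤ x → DifferentiableWithinAt ℝ y (Ici x) x
  /-- The right derivative satisfies the equation at every point of `[a, ∞)`. -/
  equation : ∀ x, a ≤ x →
    derivWithin y (Ici x) x = derivWithin y (Ici a) a - ∫ t in Ioc a x, F t (y t) ∂μ

/-- `y x ∼ A x + B` as `x → ∞` for some constants `A > 0` and `B`. -/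
def AsymptoticallyLinear (y : ℝ → ℝ) : Prop :=
  ∃ A B : ℝ, 0 < A ∧ y ~[atTop] fun x => A * x + B

/-! Necessity: the right derivative of a solution is nonincreasing, because `F` and `dσ` are
nonnegative. It cannot become negative, or the concave `y` would fall below zero. Hence the
integrals of `F t (y t)` over `(a, x]` are at most `y' a`, and since eventually `M * t ≤ y t`,
monotonicity of `F` bounds the tail of the integral of `F t (M * t)`
(`IsSolutionOn.integrableOn_Ioi`).

Sufficiency: prescribe the limiting slope `A = M / 2` and solve `y' x = A + ∫_{(x, ∞)} F t (y t) dσ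
t`. Far enough out, the tail of the integral of `F t (M * t)` is below `M / 2`, so `M * x` is an
upper solution; iterating downwards from it converges to a solution
(`exists_solution_integralEquation`). Its slope differs from `A` by a tail tending to zero, so `y x
= A * x + o(x)`. -/

/-- The tail integral `s ↦ ∫_{(s, ∞)} f dν`. -/
noncomputable def tailIntegral (ν : Measure ℝ) (f : ℝ → ℝ) (s : ℝ) : ℝ :=
  ∫ t in Ioi s, f t ∂ν

/-! ### Tail integrals and their primitives -/

section TailIntegral

variable {ν : Measure ℝ} {f : ℝ → ℝ}

theorem tailIntegral_nonneg (h0 : ∀ t, 0 ≤ f t) (s : ℝ) : 0 ≤ tailIntegral ν f s :=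
  integral_nonneg h0

theorem tailIntegral_le_integral (hf : Integrable f ν) (h0 : ∀ t, 0 ≤ f t) (s : ℝ) :
    tailIntegral ν f s ≤ ∫ t, f t ∂ν :=
  setIntegral_le_integral hf (Eventually.of_forall h0)

theorem antitone_tailIntegral (hf : Integrable f ν) (h0 : ∀ t, 0 ≤ f t) :
    Antitone (tailIntegral ν f) := fun _ _ hst =>
  setIntegral_mono_set hf.integrableOn (Eventually.of_forall h0)
    (Ioi_subset_Ioi hst).eventuallyLE

theorem tailIntegral_sub (hf : Integrable f ν) {s t : ℝ} (hst : s ≤ t) :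
    tailIntegral ν f s - tailIntegral ν f t = ∫ u in Ioc s t, f u ∂ν := by
  rw [tailIntegral, tailIntegral, ← Ioc_union_Ioi_eq_Ioi hst,
    setIntegral_union (Ioc_disjoint_Ioi le_rfl) measurableSet_Ioi hf.integrableOn hf.integrableOn]
  ring

/-- Dominated convergence for indicators of rays. It yields both right continuity and the limit at
infinity. -/
theorem tendsto_tailIntegral_of_dominated (hf : Integrable f ν) {l : Filter ℝ}
    [l.IsCountablyGenerated] {S : Set ℝ} (hS : MeasurableSet S)
    (h : ∀ t, ∀ᶠ s in l, (t ∈ Ioi s ↔ t ∈ S)) :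
    Tendsto (tailIntegral ν f) l (𝓝 (∫ t in S, f t ∂ν)) := by
  have key : Tendsto (fun s => ∫ t, (Ioi s).indicator f t ∂ν) l
      (𝓝 (∫ t, S.indicator f t ∂ν)) := by
    refine tendsto_integral_filter_of_dominated_convergence (fun t => ‖f t‖)
      (Eventually.of_forall fun s => hf.aestronglyMeasurable.indicator measurableSet_Ioi)
      (Eventually.of_forall fun s => Eventually.of_forall fun t => norm_indicator_le_norm_self _ _)
      hf.norm (Eventually.of_forall fun t => ?_)
    refine tendsto_const_nhds.congr' ?_
    filter_upwards [h t] with s hs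
    by_cases ht : t ∈ S
    · rw [indicator_of_mem ht, indicator_of_mem (hs.2 ht)]
    · rw [indicator_of_notMem ht, indicator_of_notMem (fun h' => ht (hs.1 h'))]
  rw [integral_indicator hS] at key
  exact key.congr fun s => integral_indicator measurableSet_Ioi

/-- As `s` decreases to `x`, the open rays increase to `Ioi x`. An atom of `ν` at `x` breaks
continuity only from the left, which is why right derivatives are the natural ones. -/
theorem continuousWithinAt_tailIntegral (hf : Integrable f ν) (x : ℝ) :
    ContinuousWithinAt (tailIntegral ν f) (Ioi x) x := by
  refine tendsto_tailIntegral_of_dominated hf measurableSet_Ioi fun t => ?_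
  rcases lt_or_ge x t with hxt | hxt
  · filter_upwards [mem_nhdsWithin_of_mem_nhds (Iio_mem_nhds hxt)] with s hs
    exact ⟨fun _ => hxt, fun _ => hs⟩
  · filter_upwards [self_mem_nhdsWithin] with s hs
    exact ⟨fun h => absurd (hxt.trans_lt (mem_Ioi.1 hs)) (not_lt.2 (le_of_lt h)),
      fun h => absurd (mem_Ioi.1 h) (not_lt.2 hxt)⟩

theorem tendsto_tailIntegral_atTop (hf : Integrable f ν) :
    Tendsto (tailIntegral ν f) atTop (𝓝 0) := by
  have := tendsto_tailIntegral_of_dominated (l := atTop) hf MeasurableSet.empty fun t => by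
    filter_upwards [eventually_ge_atTop t] with s hs
    simpa using hs
  simpa using this

theorem intervalIntegrable_tailIntegral (hf : Integrable f ν) (h0 : ∀ t, 0 ≤ f t) (a b : ℝ) :
    IntervalIntegrable (tailIntegral ν f) volume a b :=
  (antitone_tailIntegral hf h0).intervalIntegrable

theorem hasDerivWithinAt_integral_tailIntegral (hf : Integrable f ν) (h0 : ∀ t, 0 ≤ f t)
    (a x : ℝ) :
    HasDerivWithinAt (fun u => ∫ s in a..u, tailIntegral ν f s) (tailIntegral ν f x) (Ici x) x :=
  intervalIntegral.integral_hasDerivWithinAt_right (intervalIntegrable_tailIntegral hf h0 a x)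
    ((antitone_tailIntegral hf h0).measurable.stronglyMeasurable.stronglyMeasurableAtFilter)
    (continuousWithinAt_tailIntegral hf x)

end TailIntegral

/-- The primitive of a function tending to zero at infinity grows sublinearly. -/
theorem isLittleO_intervalIntegral_of_tendsto_zero {g : ℝ → ℝ} {a : ℝ}
    (hg : ∀ b c, IntervalIntegrable g volume b c) (h0 : Tendsto g atTop (𝓝 0)) :
    (fun x => ∫ s in a..x, g s) =o[atTop] (fun x : ℝ => x) := by
  rw [isLittleO_iff]
  intro c hc
  obtain ⟨N, hN⟩ := eventually_atTop.1
    (h0.eventually (Metric.closedBall_mem_nhds (0 : ℝ) (half_pos hc)))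
  set x₀ := max N 0
  -- The second threshold makes the fixed integral from `a` to `x₀` at most `c / 2 * x`; beyond `x₀`
  -- the integrand is at most `c / 2`.
  filter_upwards [eventually_ge_atTop x₀,
    eventually_ge_atTop (‖∫ s in a..x₀, g s‖ / (c / 2))] with x hx hx'
  rw [div_le_iff₀ (half_pos hc)] at hx'
  have hx0 : 0 ≤ x₀ := le_max_right _ _
  have hsplit := intervalIntegral.integral_add_adjacent_intervals (hg a x₀) (hg x₀ x)
  have hbound : ‖∫ s in x₀..x, g s‖ ≤ c / 2 * |x - x₀| := by
    refine intervalIntegral.norm_integral_le_of_norm_le_const fun s hs => ?_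
    rw [uIoc_of_le hx] at hs
    simpa using hN s ((le_max_left _ _).trans hs.1.le)
  rw [abs_of_nonneg (sub_nonneg.2 hx)] at hbound
  rw [← hsplit, Real.norm_of_nonneg (hx0.trans hx)]
  refine (norm_add_le _ _).trans ?_
  nlinarith

/-! ### Existence by monotone iteration -/

/-- Monotone iteration: if `x ↦ M x` is an upper solution of the integral equation
`y x = A x + ∫_a^x ∫_{(s, ∞)} G (t, y t) dν t ds` and `G` is nondecreasing in its second variable,
then the equation has a solution between `A x` and `M x`. -/
theorem exists_solution_integralEquation {ν : Measure ℝ} {G : ℝ → ℝ → ℝ} {a A M : ℝ}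
    (ha : 0 ≤ a) (hν : ∀ᵐ t ∂ν, a ≤ t)
    (hG : Continuous fun p : ℝ × ℝ => G p.1 p.2) (hG0 : ∀ t y, 0 ≤ G t y)
    (hGmono : ∀ t, Monotone (G t)) (hint : Integrable (fun t => G t (M * t)) ν)
    (hle : A + ∫ t, G t (M * t) ∂ν ≤ M) :
    ∃ y : ℝ → ℝ, (∀ x, a ≤ x → A * x ≤ y x) ∧ Integrable (fun t => G t (y t)) ν ∧
      ∀ x, y x = A * x + ∫ s in a..x, tailIntegral ν (fun t => G t (y t)) s := by
  set T : (ℝ → ℝ) → ℝ → ℝ := fun y x =>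
    A * x + ∫ s in a..x, tailIntegral ν (fun t => G t (y t)) s with hT
  set I := ∫ t, G t (M * t) ∂ν
  have hI0 : 0 ≤ I := integral_nonneg fun t => hG0 _ _
  -- Measurability is asked of the composite only, because the iterates are known to converge only
  -- on `[a, ∞)`, that is `ν`-almost everywhere.
  let P : (ℝ → ℝ) → Prop := fun y =>
    AEStronglyMeasurable (fun t => G t (y t)) ν ∧ ∀ x, a ≤ x → y x ≤ M * x
  have integ : ∀ y, P y → Integrable (fun t => G t (y t)) ν := fun y hy =>
    hint.mono' hy.1 (hν.mono fun t ht => by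
      rw [Real.norm_of_nonneg (hG0 _ _)]; exact hGmono t (hy.2 t ht))
  have tail_le : ∀ y, P y → ∀ s, tailIntegral ν (fun t => G t (y t)) s ≤ I := fun y hy s =>
    (tailIntegral_le_integral (integ y hy) (fun t => hG0 _ _) s).trans
      (integral_mono_ae (integ y hy) hint (hν.mono fun t ht => hGmono t (hy.2 t ht)))
  have contT : ∀ y, P y → Continuous (T y) := fun y hy => by
    refine (continuous_const.mul continuous_id).add
      (intervalIntegral.continuous_primitive
        (fun b c => intervalIntegrable_tailIntegral (integ y hy) (fun t => hG0 _ _) b c) a)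
  have T_lower : ∀ y x, a ≤ x → A * x ≤ T y x := fun y x hx => by
    have := intervalIntegral.integral_nonneg (μ := volume) hx
      (fun s _ => tailIntegral_nonneg (ν := ν) (f := fun t => G t (y t)) (fun t => hG0 _ _) s)
    simp only [hT]; linarith
  have T_upper : ∀ y, P y → ∀ x, a ≤ x → T y x ≤ M * x := fun y hy x hx => by
    have h := intervalIntegral.integral_mono_on (μ := volume) hx
      (intervalIntegrable_tailIntegral (integ y hy) (fun t => hG0 _ _) a x)
      (intervalIntegrable_const (c := I)) (fun s _ => tail_le y hy s)
    rw [intervalIntegral.integral_const, smul_eq_mul] at h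
    simp only [hT]
    -- `A * x + (x - a) * I ≤ (A + I) * x ≤ M * x`, using `0 ≤ a` and `0 ≤ I`.
    nlinarith
  have PT : ∀ y, P y → P (T y) := fun y hy =>
    ⟨(hG.comp (continuous_id.prodMk (contT y hy))).aestronglyMeasurable, T_upper y hy⟩
  have T_mono : ∀ y z, P y → P z → (∀ x, a ≤ x → y x ≤ z x) → ∀ x, a ≤ x → T y x ≤ T z x := by
    intro y z hy hz hyz x hx
    have h := intervalIntegral.integral_mono_on (μ := volume) hx
      (intervalIntegrable_tailIntegral (integ y hy) (fun t => hG0 _ _) a x)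
      (intervalIntegrable_tailIntegral (integ z hz) (fun t => hG0 _ _) a x)
      (fun s _ => integral_mono_ae (integ y hy).integrableOn (integ z hz).integrableOn
        (ae_restrict_of_ae (hν.mono fun t ht => hGmono t (hyz t ht))))
    simp only [hT]; linarith
  let Y : ℕ → ℝ → ℝ := fun n => T^[n] fun x => M * x
  have Y_succ : ∀ n, Y (n + 1) = T (Y n) := fun n => Function.iterate_succ_apply' T n _
  have PY : ∀ n, P (Y n) := by
    intro n
    induction n with
    | zero => exact ⟨hint.aestronglyMeasurable, fun x _ => le_rfl⟩
    | succ n ih => rw [Y_succ]; exact PT _ ih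
  have Y_anti : ∀ x, a ≤ x → Antitone fun n => Y n x := by
    have step : ∀ n x, a ≤ x → Y (n + 1) x ≤ Y n x := by
      intro n
      induction n with
      | zero => exact fun x hx => (PY 1).2 x hx
      | succ n ih =>
        intro x hx
        rw [Y_succ (n + 1)]
        nth_rewrite 2 [Y_succ n]
        exact T_mono _ _ (PY _) (PY _) ih x hx
    exact fun x hx => antitone_nat_of_succ_le fun n => step n x hx
  -- After the shift by one, every term is a value of `T`, so `T_lower` applies.
  have Y_bdd : ∀ x, a ≤ x → BddBelow (range fun n => Y (n + 1) x) := fun x hx =>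
    ⟨A * x, by rintro _ ⟨n, rfl⟩; simp only [Y_succ]; exact T_lower _ x hx⟩
  set z : ℝ → ℝ := fun x => ⨅ n, Y (n + 1) x
  have Y_lim : ∀ x, a ≤ x → Tendsto (fun n => Y n x) atTop (𝓝 (z x)) := fun x hx =>
    (tendsto_add_atTop_iff_nat 1).1
      (tendsto_atTop_ciInf (fun m n hmn => Y_anti x hx (Nat.succ_le_succ hmn)) (Y_bdd x hx))
  have G_lim : ∀ᵐ t ∂ν, Tendsto (fun n => G t (Y n t)) atTop (𝓝 (G t (z t))) :=
    hν.mono fun t ht => ((hG.comp (continuous_const.prodMk continuous_id)).tendsto (z t)).comp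
      (Y_lim t ht)
  have Pz : P z := ⟨aestronglyMeasurable_of_tendsto_ae atTop (fun n => (PY n).1) G_lim,
    fun x hx => le_of_tendsto' (Y_lim x hx) fun n => (PY n).2 x hx⟩
  have tail_lim : ∀ s, Tendsto (fun n => tailIntegral ν (fun t => G t (Y n t)) s) atTop
      (𝓝 (tailIntegral ν (fun t => G t (z t)) s)) := fun s =>
    tendsto_integral_of_dominated_convergence (fun t => G t (M * t))
      (fun n => (PY n).1.restrict) hint.integrableOn
      (fun n => ae_restrict_of_ae (hν.mono fun t ht => by
        rw [Real.norm_of_nonneg (hG0 _ _)]; exact hGmono t ((PY n).2 t ht)))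
      (ae_restrict_of_ae G_lim)
  have T_lim : ∀ x, Tendsto (fun n => T (Y n) x) atTop (𝓝 (T z x)) := fun x =>
    tendsto_const_nhds.add <| intervalIntegral.tendsto_integral_filter_of_dominated_convergence
      (fun _ => I)
      (Eventually.of_forall fun n => (antitone_tailIntegral (integ _ (PY n))
        (fun t => hG0 _ _)).measurable.aestronglyMeasurable)
      (Eventually.of_forall fun n => Eventually.of_forall fun s _ => by
        rw [Real.norm_of_nonneg (tailIntegral_nonneg (fun t => hG0 _ _) s)]
        exact tail_le _ (PY n) s)
      intervalIntegrable_const (Eventually.of_forall fun s _ => tail_lim s)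
  have z_eq : ∀ x, a ≤ x → T z x = z x := fun x hx =>
    tendsto_nhds_unique (T_lim x)
      (((tendsto_add_atTop_iff_nat 1).2 (Y_lim x hx)).congr fun n => by rw [Y_succ])
  -- `z` solves the equation only on `[a, ∞)`. `T z` agrees with it there and satisfies the equation
  -- at every real `x`.
  refine ⟨T z, T_lower z, integ _ (PT z Pz), fun x => ?_⟩
  have : ∀ s, tailIntegral ν (fun t => G t (T z t)) s = tailIntegral ν (fun t => G t (z t)) s :=
    fun s => integral_congr_ae (ae_restrict_of_ae (hν.mono fun t ht => by simp only [z_eq t ht]))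
  change T z x = A * x + ∫ s in a..x, tailIntegral ν (fun t => G t (T z t)) s
  rw [funext this]

/-! ### Extension of the nonlinearity to the plane -/

/-- The extension of a function on the quadrant `[0, ∞) × [0, ∞)` to the plane, constant along
the retraction `(x, y) ↦ (max x 0, max y 0)`. -/
noncomputable def quadrantExtend (F : ℝ → ℝ → ℝ) (x y : ℝ) : ℝ := F (max x 0) (max y 0)

section QuadrantExtend

variable {F : ℝ → ℝ → ℝ}

theorem quadrantExtend_of_nonneg {x y : ℝ} (hx : 0 ≤ x) (hy : 0 ≤ y) :
    quadrantExtend F x y = F x y := by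
  rw [quadrantExtend, max_eq_left hx, max_eq_left hy]

theorem continuous_quadrantExtend
    (hF : ContinuousOn (fun p : ℝ × ℝ => F p.1 p.2) (Ici 0 ×ˢ Ici 0)) :
    Continuous fun p : ℝ × ℝ => quadrantExtend F p.1 p.2 :=
  hF.comp_continuous (f := fun p : ℝ × ℝ => (max p.1 0, max p.2 0)) (by fun_prop)
    fun p => ⟨le_max_right p.1 0, le_max_right p.2 0⟩

theorem tendsto_quadrantExtend_zero
    (hF : ContinuousOn (fun p : ℝ × ℝ => F p.1 p.2) (Ici 0 ×ˢ Ici 0)) (x : ℝ) :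
    Tendsto (quadrantExtend F x) (𝓝[>] 0) (𝓝 (quadrantExtend F x 0)) :=
  (((continuous_quadrantExtend hF).comp (Continuous.prodMk_right x)).tendsto 0).mono_left
    nhdsWithin_le_nhds

theorem quadrantExtend_nonneg
    (hF : ContinuousOn (fun p : ℝ × ℝ => F p.1 p.2) (Ici 0 ×ˢ Ici 0))
    (hpos : ∀ x, 0 ≤ x → ∀ y, 0 < y → 0 < F x y) (x y : ℝ) : 0 ≤ quadrantExtend F x y := by
  have hpos' : ∀ y, 0 < y → 0 ≤ quadrantExtend F x y := fun y hy =>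
    (hpos _ (le_max_right _ _) _ (hy.trans_le (le_max_left _ _))).le
  rcases lt_or_ge 0 y with hy | hy
  · exact hpos' y hy
  · have h0 : 0 ≤ quadrantExtend F x 0 := ge_of_tendsto (tendsto_quadrantExtend_zero hF x)
      (by filter_upwards [self_mem_nhdsWithin] with s hs using hpos' s hs)
    simpa only [quadrantExtend, max_eq_right hy, max_self] using h0

/-- Monotonicity is assumed only for `y > 0`; continuity carries it to `y = 0`, and the extension is
constant below. -/
theorem monotone_quadrantExtend
    (hF : ContinuousOn (fun p : ℝ × ℝ => F p.1 p.2) (Ici 0 ×ˢ Ici 0))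
    (hmono : ∀ x, 0 ≤ x → MonotoneOn (F x) (Ioi 0)) (x : ℝ) : Monotone (quadrantExtend F x) := by
  have hpos : ∀ y z, 0 < y → y ≤ z → quadrantExtend F x y ≤ quadrantExtend F x z := by
    intro y z hy hyz
    rw [quadrantExtend, quadrantExtend, max_eq_left hy.le, max_eq_left (hy.le.trans hyz)]
    exact hmono _ (le_max_right _ _) hy (hy.trans_le hyz) hyz
  intro y z hyz
  rcases lt_or_ge 0 y with hy | hy
  · exact hpos y z hy hyz
  have hy0 : quadrantExtend F x y = quadrantExtend F x 0 := by
    simp only [quadrantExtend, max_eq_right hy, max_self]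
  rcases lt_or_ge 0 z with hz | hz
  · rw [hy0]
    refine le_of_tendsto (tendsto_quadrantExtend_zero hF x) ?_
    filter_upwards [Ioo_mem_nhdsGT hz] with s hs using hpos s z hs.1 hs.2.le
  · simp only [quadrantExtend, max_eq_right hy, max_eq_right hz, le_refl]

end QuadrantExtend

instance isLocallyFiniteMeasure_stieltjesMeasure (σ : ℝ → ℝ) (hmono : MonotoneOn σ (Ici 0))
    (hright : ∀ x ∈ Ici (0 : ℝ), ContinuousWithinAt σ (Ici x) x) :
    IsLocallyFiniteMeasure (stieltjesMeasure σ hmono hright) :=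
  inferInstanceAs (IsLocallyFiniteMeasure (stieltjesOfHalfLine σ hmono hright).measure)

theorem AsymptoticallyLinear.exists_pos_mul_le {y : ℝ → ℝ} (hy : AsymptoticallyLinear y) :
    ∃ M : ℝ, 0 < M ∧ ∀ᶠ x in atTop, M * x ≤ y x := by
  obtain ⟨A, B, hA, hAB⟩ := hy
  refine ⟨A / 2, half_pos hA, ?_⟩
  have hlin : Tendsto (fun x : ℝ => A * x) atTop atTop := tendsto_id.const_mul_atTop hA
  -- With relative error `1 / 4`, `y x ≥ 3 / 4 * (A * x + B)`, which is at least `A / 2 * x` once `A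
  -- * x ≥ -3 * B`.
  filter_upwards [hAB.isLittleO.bound (show (0 : ℝ) < 1 / 4 by norm_num),
    hlin.eventually_ge_atTop (-3 * B), hlin.eventually_ge_atTop (-B)] with x h1 h2 h3
  simp only [Pi.sub_apply, Real.norm_eq_abs] at h1
  rw [abs_of_nonneg (show 0 ≤ A * x + B by linarith)] at h1
  linarith [(abs_le.1 h1).1]

/-- A function `A x + o(x)` with `A > 0` is asymptotically linear. -/
theorem asymptoticallyLinear_of_isLittleO {y r : ℝ → ℝ} {A : ℝ} (hA : 0 < A)
    (hy : ∀ x, y x = A * x + r x) (hr : r =o[atTop] fun x : ℝ => x) : AsymptoticallyLinear y := by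
  refine ⟨A, 0, hA, ?_⟩
  have : (y - fun x => A * x + 0) = r := by ext x; simp [hy]
  rw [IsEquivalent, this]
  simpa using hr.const_mul_right hA.ne'

/-! ### Concavity of solutions and its consequences -/

section Solution

variable {μ : Measure ℝ} {F : ℝ → ℝ → ℝ} {a : ℝ} {y : ℝ → ℝ}

theorem IsSolutionOn.continuousOn (hy : IsSolutionOn μ F a y) {b c : ℝ} (hb : a ≤ b) :
    ContinuousOn y (Icc b c) := by
  rcases le_or_gt b c with hbc | hbc
  · have := (hy.absCont c (hb.trans hbc)).continuousOn
    rw [uIcc_of_le (hb.trans hbc)] at this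
    exact this.mono (Icc_subset_Icc_left hb)
  · rw [Icc_eq_empty hbc.not_ge]; exact continuousOn_empty y

theorem IsSolutionOn.integrableOn [IsLocallyFiniteMeasure μ] (hy : IsSolutionOn μ F a y)
    (ha : 0 ≤ a) (hF : ContinuousOn (fun p : ℝ × ℝ => F p.1 p.2) (Ici 0 ×ˢ Ici 0)) (b : ℝ) :
    IntegrableOn (fun t => F t (y t)) (Ioc a b) μ := by
  have hc : ContinuousOn (fun t => F t (y t)) (Icc a b) :=
    hF.comp (continuousOn_id.prodMk (hy.continuousOn le_rfl))
      fun t ht => ⟨ha.trans ht.1, hy.nonneg t ht.1⟩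
  exact (hc.integrableOn_compact isCompact_Icc).mono_set Ioc_subset_Icc_self

theorem IsSolutionOn.antitoneOn_derivWithin [IsLocallyFiniteMeasure μ] (hy : IsSolutionOn μ F a y)
    (ha : 0 ≤ a) (hF : ContinuousOn (fun p : ℝ × ℝ => F p.1 p.2) (Ici 0 ×ˢ Ici 0))
    (hF0 : ∀ t, a ≤ t → 0 ≤ F t (y t)) :
    AntitoneOn (fun x => derivWithin y (Ici x) x) (Ici a) := by
  intro u hu v hv huv
  simp only
  rw [hy.equation u hu, hy.equation v hv]
  refine sub_le_sub_left (setIntegral_mono_set (hy.integrableOn ha hF v) ?_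
    (Ioc_subset_Ioc_right huv).eventuallyLE) _
  filter_upwards [ae_restrict_mem measurableSet_Ioc] with t ht using hF0 t ht.1.le

/-- The right derivative of a solution is nonnegative, since solutions are concave and bounded
below. -/
theorem IsSolutionOn.derivWithin_nonneg [IsLocallyFiniteMeasure μ] (hy : IsSolutionOn μ F a y)
    (ha : 0 ≤ a) (hF : ContinuousOn (fun p : ℝ × ℝ => F p.1 p.2) (Ici 0 ×ˢ Ici 0))
    (hF0 : ∀ t, a ≤ t → 0 ≤ F t (y t)) {x : ℝ} (hx : a ≤ x) :
    0 ≤ derivWithin y (Ici x) x := by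
  by_contra! hneg
  set d := derivWithin y (Ici x) x
  have hline : ∀ v : ℝ, HasDerivWithinAt (fun u => y x + d * (u - x)) d (Ici v) v := fun v => by
    simpa using ((((hasDerivAt_id v).sub_const x).const_mul d).const_add (y x)).hasDerivWithinAt
  -- At `b` the line through `(x, y x)` of slope `d` has height `-1`; by concavity `y` lies below
  -- that line.
  set b := x + (y x + 1) / (-d) with hb
  have hpos : 0 ≤ (y x + 1) / (-d) :=
    div_nonneg (by linarith [hy.nonneg x hx]) (by linarith)
  have hxb : x ≤ b := by linarith
  have key := image_le_of_deriv_right_le_deriv_boundary (f := y)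
    (f' := fun u => derivWithin y (Ici u) u) (a := x) (b := b) (hy.continuousOn hx)
    (fun u hu => (hy.differentiable u (hx.trans hu.1)).hasDerivWithinAt)
    (B := fun u => y x + d * (u - x)) (B' := fun _ => d) (by simp) (by fun_prop)
    (fun u _ => hline u)
    (fun u hu => hy.antitoneOn_derivWithin ha hF hF0 hx (hx.trans hu.1) hu.1)
    (right_mem_Icc.2 hxb)
  have hdb : d * (b - x) = -(y x + 1) := by
    rw [hb, add_sub_cancel_left, div_neg, mul_neg, mul_div_cancel₀ _ hneg.ne]
  simp only [hdb] at key
  linarith [hy.nonneg b (hx.trans hxb)]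

/-- The integral over `(a, b]` is `y' a - y' b`, which is at most `y' a`. -/
theorem IsSolutionOn.integrableOn_Ioi [IsLocallyFiniteMeasure μ] (hy : IsSolutionOn μ F a y)
    (ha : 0 ≤ a) (hF : ContinuousOn (fun p : ℝ × ℝ => F p.1 p.2) (Ici 0 ×ˢ Ici 0))
    (hF0 : ∀ t, a ≤ t → 0 ≤ F t (y t)) :
    IntegrableOn (fun t => F t (y t)) (Ioi a) μ := by
  refine integrableOn_Ioi_of_intervalIntegral_norm_bounded (derivWithin y (Ici a) a) a
    (fun b => hy.integrableOn ha hF b) tendsto_id ?_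
  filter_upwards [eventually_ge_atTop a] with b hb
  have hnorm : ∫ t in Ioc a b, ‖F t (y t)‖ ∂μ = ∫ t in Ioc a b, F t (y t) ∂μ :=
    setIntegral_congr_fun measurableSet_Ioc fun t ht => Real.norm_of_nonneg (hF0 t ht.1.le)
  rw [intervalIntegral.integral_of_le hb, hnorm]
  linarith [hy.equation b hb, hy.derivWithin_nonneg ha hF hF0 hb]

end Solution

/-! ### The two implications -/

section MainTheorem

variable {μ : Measure ℝ} {F : ℝ → ℝ → ℝ}

theorem exists_integrableOn_linear_of_solution [IsLocallyFiniteMeasure μ]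
    (hF : ContinuousOn (fun p : ℝ × ℝ => F p.1 p.2) (Ici 0 ×ˢ Ici 0))
    (hpos : ∀ x, 0 ≤ x → ∀ y, 0 < y → 0 < F x y)
    (hmono : ∀ x, 0 ≤ x → MonotoneOn (F x) (Ioi 0)) {a : ℝ} (ha : 0 ≤ a) {y : ℝ → ℝ}
    (hy : IsSolutionOn μ F a y) (hlin : AsymptoticallyLinear y) :
    ∃ M : ℝ, 0 < M ∧ IntegrableOn (fun t => F t (M * t)) (Ioi 0) μ := by
  have hF0 : ∀ t, a ≤ t → 0 ≤ F t (y t) := fun t ht => by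
    rw [← quadrantExtend_of_nonneg (F := F) (ha.trans ht) (hy.nonneg t ht)]
    exact quadrantExtend_nonneg hF hpos _ _
  obtain ⟨M, hM, hev⟩ := hlin.exists_pos_mul_le
  obtain ⟨b, hb⟩ := eventually_atTop.1 hev
  set c := max a b
  have hac : a ≤ c := le_max_left _ _
  have hcont : ContinuousOn (fun t => F t (M * t)) (Ici 0) :=
    hF.comp (f := fun t => (t, M * t)) (by fun_prop) fun t ht => ⟨ht, mul_nonneg hM.le ht⟩
  refine ⟨M, hM, ?_⟩
  -- On `(0, c]` continuity and local finiteness of `μ` suffice; beyond `c` the integrand is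
  -- dominated by `F t (y t)`.
  rw [← Ioc_union_Ioi_eq_Ioi (ha.trans hac)]
  refine IntegrableOn.union ?_ ?_
  · exact ((hcont.mono Icc_subset_Ici_self).integrableOn_compact isCompact_Icc).mono_set
      Ioc_subset_Icc_self
  · refine Integrable.mono' ((hy.integrableOn_Ioi ha hF hF0).mono_set (Ioi_subset_Ioi hac))
      ((hcont.mono fun t ht => (ha.trans hac).trans (le_of_lt ht)).aestronglyMeasurable
        measurableSet_Ioi) ?_
    filter_upwards [ae_restrict_mem measurableSet_Ioi] with t ht
    have ht0 : 0 < t := (ha.trans hac).trans_lt ht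
    have hMt : M * t ≤ y t := hb t ((le_max_right a b).trans (le_of_lt ht))
    rw [Real.norm_of_nonneg (hpos t ht0.le _ (mul_pos hM ht0)).le]
    exact hmono t ht0.le (mul_pos hM ht0) ((mul_pos hM ht0).trans_le hMt) hMt

theorem exists_solution_of_integrableOn_linear
    (hF : ContinuousOn (fun p : ℝ × ℝ => F p.1 p.2) (Ici 0 ×ˢ Ici 0))
    (hpos : ∀ x, 0 ≤ x → ∀ y, 0 < y → 0 < F x y)
    (hmono : ∀ x, 0 ≤ x → MonotoneOn (F x) (Ioi 0)) {M : ℝ} (hM : 0 < M)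
    (hint : IntegrableOn (fun t => F t (M * t)) (Ioi 0) μ) :
    ∃ a : ℝ, 0 ≤ a ∧ ∃ y : ℝ → ℝ, IsSolutionOn μ F a y ∧ AsymptoticallyLinear y := by
  set G := quadrantExtend F
  have hG := continuous_quadrantExtend hF
  have hG0 := quadrantExtend_nonneg hF hpos
  have hGM : ∀ t, 0 < t → F t (M * t) = G t (M * t) := fun t ht =>
    (quadrantExtend_of_nonneg ht.le (mul_pos hM ht).le).symm
  have hintG : IntegrableOn (fun t => G t (M * t)) (Ioi 0) μ :=
    hint.congr_fun (fun t ht => hGM t ht) measurableSet_Ioi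
  -- A tail below `M / 2` leaves room for the slope `A = M / 2` under the upper solution `M * x`.
  obtain ⟨a, haM, ha⟩ := (((tendsto_tailIntegral_atTop hintG).eventually
    (gt_mem_nhds (half_pos hM))).and (eventually_ge_atTop 0)).exists
  rw [tailIntegral, Measure.restrict_restrict measurableSet_Ioi,
    inter_eq_left.2 (Ioi_subset_Ioi ha)] at haM
  set ν := μ.restrict (Ioi a)
  have hν : ∀ᵐ t ∂ν, a ≤ t := by
    filter_upwards [ae_restrict_mem measurableSet_Ioi] with t ht using le_of_lt ht
  obtain ⟨y, hyA, hyint, hyeq⟩ := exists_solution_integralEquation (A := M / 2) ha hν hG hG0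
    (monotone_quadrantExtend hF hmono) (hintG.mono_set (Ioi_subset_Ioi ha)) (by linarith)
  have hG0' : ∀ t, 0 ≤ G t (y t) := fun t => hG0 _ _
  have hy0 : ∀ x, a ≤ x → 0 ≤ y x := fun x hx =>
    (mul_nonneg (half_pos hM).le (ha.trans hx)).trans (hyA x hx)
  have hderiv : ∀ x, HasDerivWithinAt y (M / 2 + tailIntegral ν (fun t => G t (y t)) x)
      (Ici x) x := fun x => by
    have h1 : HasDerivWithinAt (fun x => M / 2 * x) (M / 2) (Ici x) x := by
      simpa using ((hasDerivAt_id x).const_mul (M / 2)).hasDerivWithinAt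
    exact (h1.add (hasDerivWithinAt_integral_tailIntegral hyint hG0' a x)).congr
      (fun u _ => hyeq u) (hyeq x)
  have hderiv' := fun x => (hderiv x).derivWithin (uniqueDiffOn_Ici x x self_mem_Ici)
  refine ⟨a, ha, y, ⟨fun b hb => ?_, hy0, fun x _ => (hderiv x).differentiableWithinAt,
    fun x hx => ?_⟩, ?_⟩
  · have h1 : AbsolutelyContinuousOnInterval (fun x : ℝ => M / 2 * x) a b :=
      (contDiff_const.mul contDiff_id).contDiffOn.absolutelyContinuousOnInterval
    have h2 := (intervalIntegrable_tailIntegral hyint hG0' a b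
      ).absolutelyContinuousOnInterval_intervalIntegral left_mem_uIcc
    rw [show y = (fun x : ℝ => M / 2 * x) + _ from funext hyeq]
    exact h1.add h2
  -- The difference of the right derivatives at `a` and `x` is a difference of tails, hence the
  -- integral over `(a, x]`.
  · have h := tailIntegral_sub hyint hx
    rw [Measure.restrict_restrict measurableSet_Ioc, inter_eq_left.2 Ioc_subset_Ioi_self,
      setIntegral_congr_fun (g := fun t => F t (y t)) measurableSet_Ioc fun t ht =>
        quadrantExtend_of_nonneg (ha.trans ht.1.le) (hy0 t ht.1.le)] at h
    rw [hderiv', hderiv', ← h]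
    ring
  · exact asymptoticallyLinear_of_isLittleO (half_pos hM) hyeq
      (isLittleO_intervalIntegral_of_tendsto_zero
        (intervalIntegrable_tailIntegral hyint hG0') (tendsto_tailIntegral_atTop hyint))

/-- `ENNReal.ofReal` truncates nothing here, the integrand being positive on `(0, ∞)`. -/
theorem lintegral_linear_lt_top_iff
    (hF : ContinuousOn (fun p : ℝ × ℝ => F p.1 p.2) (Ici 0 ×ˢ Ici 0))
    (hpos : ∀ x, 0 ≤ x → ∀ y, 0 < y → 0 < F x y) {M : ℝ} (hM : 0 < M) :
    ∫⁻ t in Ioi (0 : ℝ), ENNReal.ofReal (F t (M * t)) ∂μ < ⊤ ↔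
      IntegrableOn (fun t => F t (M * t)) (Ioi 0) μ := by
  have hcont : ContinuousOn (fun t => F t (M * t)) (Ioi 0) :=
    hF.comp (f := fun t => (t, M * t)) (by fun_prop)
      fun t ht => ⟨Ioi_subset_Ici_self ht, (mul_pos hM ht).le⟩
  rw [lt_top_iff_ne_top]
  refine lintegral_ofReal_ne_top_iff_integrable (hcont.aestronglyMeasurable measurableSet_Ioi) ?_
  filter_upwards [ae_restrict_mem measurableSet_Ioi] with t ht
  exact (hpos t (le_of_lt ht) _ (mul_pos hM ht)).le

end MainTheorem

theorem theorem4p8 (σ : ℝ → ℝ) (hmono : MonotoneOn σ (Ici 0))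
    (hright : ∀ x ∈ Ici (0 : ℝ), ContinuousWithinAt σ (Ici x) x)
    (F : ℝ → ℝ → ℝ)
    (hFcont : ContinuousOn (fun p : ℝ × ℝ => F p.1 p.2) (Ici 0 ×ˢ Ici 0))
    (hFpos : ∀ x, 0 ≤ x → ∀ y, 0 < y → 0 < F x y)
    (hFmono : ∀ x, 0 ≤ x → MonotoneOn (F x) (Ioi 0)) :
    (∃ a : ℝ, 0 ≤ a ∧ ∃ y : ℝ → ℝ,
        IsSolutionOn (stieltjesMeasure σ hmono hright) F a y ∧ AsymptoticallyLinear y) ↔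
      ∃ M : ℝ, 0 < M ∧
        ∫⁻ t in Ioi (0 : ℝ), ENNReal.ofReal (F t (M * t)) ∂(stieltjesMeasure σ hmono hright)
          < ⊤ := by
  constructor
  · rintro ⟨a, ha, y, hy, hlin⟩
    obtain ⟨M, hM, hint⟩ := exists_integrableOn_linear_of_solution hFcont hFpos hFmono ha hy hlin
    exact ⟨M, hM, (lintegral_linear_lt_top_iff hFcont hFpos hM).2 hint⟩
  · rintro ⟨M, hM, hfin⟩
    exact exists_solution_of_integrableOn_linear hFcont hFpos hFmono hM
      ((lintegral_linear_lt_top_iff hFcont hFpos hM).1 hfin)
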